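/- Let $\Bbbk$ be a perfect field of characteristic $p>0$, let $A=\Bbbk[[x_1,\dots,x_s]]$ with $s\ge 0$, let $f$ be an element of the maximal ideal of $A$, and put $R=A/(f)$. For $n\in\mathbb{N}$ let $R^{1/p^n}$ denote $R$ regarded as an $R$-module through the $n$-th iterate of the Frobenius endomorphism, that is, $r$ acts as multiplication by $r^{p^n}$ (if $R$ is reduced, this is the ring of $p^n$-th roots of elements of $R$). Let $\mathrm{FS}_R(n)$ be the maximal rank of a free $R$-module that is a direct summand of $R^{1/p^n}$. The F-signature series of $R$ is $\mathrm{FSS}_R(z)=\sum_{n\ge 0}\mathrm{FS}_R(n)z^n\in\mathbb{Q}[[z]]$; it is called rational if it is a quotient of two polynomials in $\mathbb{Q}[z]$. Let $\mathscr{I}=[0,1]\cap\{a/p^m : a,m\in\mathbb{N}\}$ and $\mathscr{V}=\{1/p^m : m\in\mathbb{N}\}\subseteq\mathscr{I}$. Let $\phi_{f,p}:\mathscr{I}\to\mathbb{Q}$ be the (well-defined) function $$\phi_{f,p}\left(\frac{a}{p^n}\right)=p^{-sn}\dim_{\Bbbk}\left(A/(x_1^{p^n},\dots,x_s^{p^n},f^a)\right),$$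 and let $\overline{\phi}_{f,p}(t)=\phi_{f,p}(1-t)$ for $t\in\mathscr{I}$ be its reflection. A function $\phi:\mathscr{V}\to\mathbb{Q}$ is called a weak $p$-fractal if it lies in a finite-dimensional $\mathbb{Q}$-subspace of $\mathbb{Q}^{\mathscr{V}}$ that is stable under all the operators $T_{p^n|0}$, $n\in\mathbb{N}$, where $(T_{p^n|0}\psi)(1/p^m)=\psi(1/p^{m+n})$. Then $\mathrm{FSS}_R(z)$ is rational if and only if the restriction of $\overline{\phi}_{f,p}$ to $\mathscr{V}$ is a weak $p$-fractal. -/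

import Mathlib

noncomputable section

namespace WeakFractal

/-! ### Weak `p`-fractals -/

/-- The set `𝓘 = [0,1] ∩ {a / p ^ m : a, m ∈ ℕ}`. -/
def unitPAdic (p : ℕ) : Set ℚ := {t | 0 ≤ t ∧ t ≤ 1 ∧ ∃ a m : ℕ, t = a / (p : ℚ) ^ m}

/-- The set `𝓥 = {1 / p ^ m : m ∈ ℕ}`. -/
def invPowers (p : ℕ) : Set ℚ := {t | ∃ m : ℕ, t = 1 / (p : ℚ) ^ m}

/-- The point `1 / p ^ m` of `𝓥`. -/
def invPow (p m : ℕ) : invPowers p := ⟨1 / (p : ℚ) ^ m, m, rfl⟩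

lemma div_pow_mem_invPowers {p : ℕ} (n : ℕ) (t : invPowers p) :
    (t : ℚ) / (p : ℚ) ^ n ∈ invPowers p := by
  obtain ⟨t, m, rfl⟩ := t
  exact ⟨m + n, by rw [div_div, pow_add]⟩

lemma invPowers_subset (p : ℕ) [hp : Fact p.Prime] : invPowers p ⊆ unitPAdic p := by
  rintro t ⟨m, rfl⟩
  have h1 : (1 : ℚ) ≤ (p : ℚ) ^ m := one_le_pow₀ (by exact_mod_cast hp.out.one_le)
  refine ⟨by positivity, ?_, 1, m, by simp⟩
  rw [div_le_one (by linarith)]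
  exact h1

lemma one_sub_mem_unitPAdic {p : ℕ} [hp : Fact p.Prime] (t : unitPAdic p) :
    1 - (t : ℚ) ∈ unitPAdic p := by
  obtain ⟨t, h0, h1, a, m, rfl⟩ := t
  have hp0 : (0 : ℚ) < (p : ℚ) ^ m := pow_pos (by exact_mod_cast hp.out.pos) m
  have ha : a ≤ p ^ m := by
    rw [div_le_one hp0] at h1
    exact_mod_cast h1
  refine ⟨sub_nonneg.2 h1, sub_le_self _ h0, p ^ m - a, m, ?_⟩
  push_cast [Nat.cast_sub ha]
  field_simp

/-- The operator `T_{p^n|0}` on `ℚ^𝓥`, `(T_{p^n|0} φ)(1 / p ^ m) = φ (1 / p ^ (m + n))`. -/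
def shift (p n : ℕ) (φ : invPowers p → ℚ) : invPowers p → ℚ :=
  fun t => φ ⟨(t : ℚ) / (p : ℚ) ^ n, div_pow_mem_invPowers n t⟩

lemma shift_invPow (p n m : ℕ) (φ : invPowers p → ℚ) :
    shift p n φ (invPow p m) = φ (invPow p (m + n)) := by
  unfold shift invPow
  congr 2
  rw [div_div, pow_add]

/-- `φ ∈ ℚ^𝓥` is a weak `p`-fractal if it lies in a finite-dimensional subspace of `ℚ^𝓥` that is
stable under all the operators `T_{p^n|0}`. -/
def IsWeakPFractal (p : ℕ) (φ : invPowers p → ℚ) : Prop :=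
  ∃ W : Submodule ℚ (invPowers p → ℚ), FiniteDimensional ℚ W ∧ φ ∈ W ∧
    ∀ n : ℕ, ∀ ψ ∈ W, shift p n ψ ∈ W

/-- The reflection `t ↦ φ (1 - t)` of a function on `𝓘`. -/
def reflection (p : ℕ) [Fact p.Prime] (φ : unitPAdic p → ℚ) : unitPAdic p → ℚ :=
  fun t => φ ⟨1 - (t : ℚ), one_sub_mem_unitPAdic t⟩

/-- The restriction to `𝓥` of a function on `𝓘`. -/
def restrict (p : ℕ) [Fact p.Prime] (φ : unitPAdic p → ℚ) : invPowers p → ℚ :=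
  fun t => φ ⟨(t : ℚ), invPowers_subset p t.2⟩

/-! ### Rational generating series -/

/-- A power series over `ℚ` is a rational function if it is a quotient of two polynomials. -/
def IsRationalSeries (G : PowerSeries ℚ) : Prop :=
  ∃ P Q : Polynomial ℚ, Q ≠ 0 ∧ (Q : PowerSeries ℚ) * G = (P : PowerSeries ℚ)

/-! ### The F-signature function and series -/

/-- The maximal rank of a free direct summand of the `R`-module `M`. -/
def freeRank (R M : Type*) [CommRing R] [AddCommGroup M] [Module R M] : ℕ :=
  sSup {r : ℕ | ∃ F N : Submodule R M, IsCompl F N ∧ Nonempty (F ≃ₗ[R] (Fin r → R))}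

/-- `R ^ (1 / p ^ n)` as an `R`-module: the abelian group `R`, where `r ∈ R` acts as multiplication
by `r ^ (p ^ n)`, so that `x` stands for `x ^ (1 / p ^ n)`. For reduced `R` this is the ring of
`p ^ n`-th roots of elements of `R`; in general it is the `n`-th Frobenius pushforward of `R`. -/
def FrobeniusRoot (R : Type*) (_p _n : ℕ) : Type _ := R

instance (R : Type*) [CommRing R] (p n : ℕ) : AddCommGroup (FrobeniusRoot R p n) :=
  inferInstanceAs (AddCommGroup R)

instance (R : Type*) [CommRing R] (p n : ℕ) [ExpChar R p] : Module R (FrobeniusRoot R p n) :=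
  Module.compHom R (iterateFrobenius R p n)

/-- The F-signature function `FS_R(n) = frk_R (R ^ (1 / p ^ n))`. -/
def fSignature (R : Type*) [CommRing R] (p : ℕ) [ExpChar R p] (n : ℕ) : ℕ :=
  freeRank R (FrobeniusRoot R p n)

/-- The F-signature series `∑ FS_R(n) z ^ n`. -/
def fSignatureSeries (R : Type*) [CommRing R] (p : ℕ) [ExpChar R p] : PowerSeries ℚ :=
  PowerSeries.mk fun n => (fSignature R p n : ℚ)

/-! ### Hypersurfaces -/

/-- The hypersurface ring `A / f` for `f` in the maximal ideal of `A = k⟦x₁, …, x_s⟧`. -/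
abbrev Hypersurface {k : Type*} [Field k] {s : ℕ}
    (f : IsLocalRing.maximalIdeal (MvPowerSeries (Fin s) k)) : Type _ :=
  MvPowerSeries (Fin s) k ⧸ Ideal.span {(f : MvPowerSeries (Fin s) k)}

lemma hypersurface_nontrivial {k : Type*} [Field k] {s : ℕ}
    (f : IsLocalRing.maximalIdeal (MvPowerSeries (Fin s) k)) : Nontrivial (Hypersurface f) := by
  rw [Ideal.Quotient.nontrivial_iff]
  intro h
  rw [Ideal.span_singleton_eq_top] at h
  exact (IsLocalRing.mem_maximalIdeal _).1 f.2 h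

instance {k : Type*} [Field k] {s : ℕ} (p : ℕ) [CharP k p]
    (f : IsLocalRing.maximalIdeal (MvPowerSeries (Fin s) k)) : CharP (Hypersurface f) p :=
  have := hypersurface_nontrivial f
  charP_of_injective_algebraMap (algebraMap k (Hypersurface f)).injective p

/-- The ideal `(x₁ ^ q, …, x_s ^ q, f ^ a)` of `k⟦x₁, …, x_s⟧`. -/
def powIdeal {k : Type*} [Field k] {s : ℕ} (f : MvPowerSeries (Fin s) k) (q a : ℕ) :
    Ideal (MvPowerSeries (Fin s) k) :=
  Ideal.span (Set.range (fun i : Fin s => (MvPowerSeries.X i : MvPowerSeries (Fin s) k) ^ q))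
    ⊔ Ideal.span {f ^ a}

/-- The function `φ_{f,p} : 𝓘 → ℚ`,
`a / p ^ n ↦ p ^ (- s n) * dim_k k⟦x₁, …, x_s⟧ / (x₁ ^ (p ^ n), …, x_s ^ (p ^ n), f ^ a)`,
computed from the representation of `a / p ^ n` in lowest terms. The value is the same for every
other representation, see `phi_eq`. -/
def phi {k : Type*} [Field k] {s : ℕ} (p : ℕ) (f : MvPowerSeries (Fin s) k) :
    unitPAdic p → ℚ :=
  fun t => (((t : ℚ).den : ℚ) ^ s)⁻¹ *
    (Module.finrank k
      (MvPowerSeries (Fin s) k ⧸ powIdeal f (t : ℚ).den (t : ℚ).num.toNat) : ℚ)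

/-! The value of `phi` does not depend on the representation of the argument. -/

section wellDefined

open MvPowerSeries

lemma coeff_pow_smul {k : Type*} [Field k] {s p : ℕ} [hp : Fact p.Prime] [CharP k p]
    (g : MvPowerSeries (Fin s) k) (m : Fin s →₀ ℕ) :
    coeff (p • m) (g ^ p) = (coeff m g) ^ p := by
  rw [← map_frobenius_expand p hp.out.ne_zero, coeff_map, coeff_expand_smul, frobenius_def]

lemma coeff_pow_not_dvd {k : Type*} [Field k] {s p : ℕ} [hp : Fact p.Prime] [CharP k p]
    (g : MvPowerSeries (Fin s) k) (m : Fin s →₀ ℕ) (i : Fin s) (h : ¬ p ∣ m i) :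
    coeff m (g ^ p) = 0 := by
  rw [← map_frobenius_expand p hp.out.ne_zero, coeff_map, coeff_expand_of_not_dvd _ _ _ h,
    map_zero]

/-- The exponent vector attached to a tuple of residues. -/
def expo {s p : ℕ} (e : Fin s → Fin p) : Fin s →₀ ℕ := Finsupp.equivFunOnFinite.symm fun i => e i

@[simp] lemma expo_apply {s p : ℕ} (e : Fin s → Fin p) (i : Fin s) : expo e i = e i := rfl

lemma coeff_monomial_pow {k : Type*} [Field k] {s p : ℕ} [hp : Fact p.Prime] [CharP k p]
    (g : MvPowerSeries (Fin s) k) (m : Fin s →₀ ℕ) (e e' : Fin s → Fin p) :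
    coeff (p • m + expo e) (monomial (expo e') 1 * g ^ p) =
      if e' = e then (coeff m g) ^ p else 0 := by
  split_ifs with h
  · subst h
    rw [add_comm, coeff_add_monomial_mul, one_mul, coeff_pow_smul]
  · rw [coeff_monomial_mul]
    split_ifs with hle
    · obtain ⟨i, hi⟩ := Function.ne_iff.1 h
      rw [one_mul]
      apply coeff_pow_not_dvd _ _ i
      intro hd
      apply hi
      have h1 := hle i
      have h2 := (e i).2
      have h3 := (e' i).2
      simp only [Finsupp.coe_tsub, Finsupp.coe_add, Finsupp.coe_smul, Pi.add_apply, Pi.sub_apply,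
        Pi.smul_apply, expo_apply, smul_eq_mul] at hd h1
      have h4 := (Nat.modEq_iff_dvd' h1).2 hd
      have h5 : (e' i : ℕ) % p = (e i : ℕ) % p := by
        simpa [Nat.ModEq] using h4
      rw [Nat.mod_eq_of_lt h2, Nat.mod_eq_of_lt h3] at h5
      exact Fin.ext h5
    · rfl

/-- `(g_e) ↦ ∑ x ^ e * g_e ^ p`. -/
def assemble {k : Type*} [Field k] {s : ℕ} (p : ℕ) [Fact p.Prime] [CharP k p] :
    ((Fin s → Fin p) → MvPowerSeries (Fin s) k) →+ MvPowerSeries (Fin s) k where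
  toFun g := ∑ e, monomial (expo e) 1 * g e ^ p
  map_zero' := by simp [(Fact.out : p.Prime).ne_zero]
  map_add' g h := by
    have : ExpChar (MvPowerSeries (Fin s) k) p :=
      expChar_of_injective_algebraMap (algebraMap k (MvPowerSeries (Fin s) k)).injective p
    simp [add_pow_expChar, mul_add, Finset.sum_add_distrib]

lemma coeff_assemble {k : Type*} [Field k] {s p : ℕ} [hp : Fact p.Prime] [CharP k p]
    (g : (Fin s → Fin p) → MvPowerSeries (Fin s) k) (m : Fin s →₀ ℕ) (e : Fin s → Fin p) :
    coeff (p • m + expo e) (assemble p g) = (coeff m (g e)) ^ p := by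
  simp [assemble, coeff_monomial_pow]

lemma assemble_mul {k : Type*} [Field k] {s p : ℕ} [hp : Fact p.Prime] [CharP k p]
    (a : MvPowerSeries (Fin s) k) (g : (Fin s → Fin p) → MvPowerSeries (Fin s) k) :
    assemble p (fun e => a * g e) = a ^ p * assemble p g := by
  simp only [assemble, AddMonoidHom.coe_mk, ZeroHom.coe_mk, mul_pow, Finset.mul_sum]
  exact Finset.sum_congr rfl fun _ _ => by ring

lemma exists_decomp {s p : ℕ} [hp : Fact p.Prime] (n : Fin s →₀ ℕ) :
    ∃ (m : Fin s →₀ ℕ) (e : Fin s → Fin p), n = p • m + expo e := by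
  refine ⟨n.mapRange (fun a => a / p) (by simp),
    fun i => ⟨n i % p, Nat.mod_lt _ hp.out.pos⟩, ?_⟩
  ext i
  simp [Nat.div_add_mod]

lemma assemble_injective {k : Type*} [Field k] {s p : ℕ} [hp : Fact p.Prime] [CharP k p] :
    Function.Injective (assemble (k := k) (s := s) p) := by
  rw [injective_iff_map_eq_zero]
  intro g hg
  funext e
  ext m
  have := coeff_assemble g m e
  rw [hg, map_zero] at this
  simpa using (pow_eq_zero_iff hp.out.ne_zero).1 this.symm

lemma assemble_surjective {k : Type*} [Field k] {s p : ℕ} [hp : Fact p.Prime] [CharP k p]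
    [PerfectField k] : Function.Surjective (assemble (k := k) (s := s) p) := by
  intro h
  have : PerfectRing k p := PerfectField.toPerfectRing p
  have hs := (PerfectRing.bijective_frobenius (R := k) (p := p)).2
  choose r hr using hs
  let g : (Fin s → Fin p) → MvPowerSeries (Fin s) k :=
    fun e m => r (coeff (p • m + expo e) h)
  refine ⟨g, ?_⟩
  ext n
  obtain ⟨m, e, rfl⟩ := exists_decomp (p := p) n
  rw [coeff_assemble]
  exact hr _

lemma finrank_quotient_map_frobenius {k : Type*} [Field k] {s p : ℕ} [hp : Fact p.Prime]
    [CharP k p] [PerfectField k] [ExpChar (MvPowerSeries (Fin s) k) p]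
    (I : Ideal (MvPowerSeries (Fin s) k)) :
    Module.finrank k (MvPowerSeries (Fin s) k ⧸ I.map (frobenius (MvPowerSeries (Fin s) k) p)) =
      p ^ s * Module.finrank k (MvPowerSeries (Fin s) k ⧸ I) := by
  have : PerfectRing k p := PerfectField.toPerfectRing p
  set A := MvPowerSeries (Fin s) k
  set J := I.map (frobenius A p)
  have hmem : ∀ g : (Fin s → Fin p) → A, assemble p g ∈ J ↔ ∀ e, g e ∈ I := by
    intro g
    constructor
    · intro hg
      have key : ∀ y ∈ J, ∃ g : (Fin s → Fin p) → A, (∀ e, g e ∈ I) ∧ assemble p g = y := by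
        intro y hy
        refine Submodule.span_induction (p := fun y _ =>
          ∃ g : (Fin s → Fin p) → A, (∀ e, g e ∈ I) ∧ assemble p g = y) ?_ ?_ ?_ ?_ hy
        · rintro _ ⟨x, hx, rfl⟩
          obtain ⟨u, hu⟩ := assemble_surjective (k := k) (s := s) (p := p) 1
          refine ⟨fun e => x * u e, fun e => I.mul_mem_right _ hx, ?_⟩
          rw [assemble_mul, hu, mul_one]
          rfl
        · exact ⟨0, fun e => I.zero_mem, map_zero _⟩
        · rintro x y - - ⟨g, hg, rfl⟩ ⟨h, hh, rfl⟩
          exact ⟨g + h, fun e => I.add_mem (hg e) (hh e), map_add _ _ _⟩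
        · rintro a x - ⟨g, hg, rfl⟩
          obtain ⟨u, rfl⟩ := assemble_surjective (k := k) (s := s) (p := p) a
          classical
          choose w hw using fun e : Fin s → Fin p =>
            assemble_surjective (k := k) (s := s) (p := p)
              (assemble p u * monomial (expo e) 1)
          refine ⟨∑ e, fun e' => g e * w e e', fun e' => ?_, ?_⟩
          · rw [Finset.sum_apply]
            exact I.sum_mem fun e _ => I.mul_mem_right _ (hg e)
          · rw [map_sum, smul_eq_mul]
            simp only [assemble_mul, hw]
            have e1 : assemble p g = ∑ e, monomial (expo e) 1 * g e ^ p := rfl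
            rw [e1, Finset.mul_sum]
            exact Finset.sum_congr rfl fun _ _ => by ring
      obtain ⟨g', hg', he⟩ := key _ hg
      rw [assemble_injective he] at hg'
      exact hg'
    · intro hg
      refine J.sum_mem fun e _ => J.mul_mem_left _ ?_
      exact Ideal.mem_map_of_mem (frobenius A p) (hg e)
  let Ψ : ((Fin s → Fin p) → A) ≃+ A :=
    AddEquiv.ofBijective (assemble p) ⟨assemble_injective, assemble_surjective⟩
  let P : ((Fin s → Fin p) → A) →+ ((Fin s → Fin p) → A ⧸ I) :=
    { toFun := fun g e => Ideal.Quotient.mk I (g e)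
      map_zero' := by ext; simp
      map_add' := fun g h => by ext; simp }
  let j₀ : A →+ ((Fin s → Fin p) → A ⧸ I) := P.comp Ψ.symm.toAddMonoidHom
  have hj₀ : ∀ g, j₀ (assemble p g) = fun e => Ideal.Quotient.mk I (g e) := by
    intro g
    change P (Ψ.symm (Ψ g)) = _
    rw [Ψ.symm_apply_apply]
    rfl
  have hker : ∀ a, j₀ a = 0 ↔ a ∈ J := by
    intro a
    obtain ⟨g, rfl⟩ := assemble_surjective (k := k) (s := s) (p := p) a
    rw [hj₀, hmem, funext_iff]
    simp [Ideal.Quotient.eq_zero_iff_mem]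
  let j : (A ⧸ J) →+ ((Fin s → Fin p) → A ⧸ I) :=
    QuotientAddGroup.lift J.toAddSubgroup j₀ (fun a ha => (hker a).2 ha)
  have hj : ∀ a, j (Ideal.Quotient.mk J a) = j₀ a := fun a => rfl
  have hjb : Function.Bijective j := by
    constructor
    · rw [injective_iff_map_eq_zero]
      intro x hx
      obtain ⟨a, rfl⟩ := Ideal.Quotient.mk_surjective x
      rw [hj, hker] at hx
      exact Ideal.Quotient.eq_zero_iff_mem.2 hx
    · intro y
      choose g hg using fun e => Ideal.Quotient.mk_surjective (y e)
      refine ⟨Ideal.Quotient.mk J (assemble p g), ?_⟩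
      rw [hj, hj₀]
      exact funext hg
  have hsm : ∀ (c : k) (x : A ⧸ J), j (c • x) = (frobeniusEquiv k p).symm c • j x := by
    intro c x
    obtain ⟨c, rfl⟩ := (frobeniusEquiv k p).surjective c
    obtain ⟨a, rfl⟩ := Ideal.Quotient.mk_surjective x
    obtain ⟨g, rfl⟩ := assemble_surjective (k := k) (s := s) (p := p) a
    have e1 : (frobeniusEquiv k p c) • Ideal.Quotient.mk J (assemble p g) =
        Ideal.Quotient.mk J (assemble p (fun e => C c * g e)) := by
      rw [assemble_mul, ← map_pow, ← smul_eq_C_mul]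
      rfl
    rw [e1, hj, hj, hj₀, hj₀, RingEquiv.symm_apply_apply]
    funext e
    rw [← smul_eq_C_mul]
    rfl
  have hrank := rank_eq_of_equiv_equiv (R := k) (R' := k) (frobeniusEquiv k p).symm
    (AddEquiv.ofBijective j hjb) (frobeniusEquiv k p).symm.bijective hsm
  rw [rank_fun_eq_lift_mul] at hrank
  have hfin := congrArg Cardinal.toNat hrank
  rw [Cardinal.toNat_mul, Cardinal.toNat_lift, Cardinal.toNat_natCast, Fintype.card_fun,
    Fintype.card_fin, Fintype.card_fin] at hfin
  exact hfin

lemma map_frobenius_powIdeal {k : Type*} [Field k] {s p : ℕ}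
    [ExpChar (MvPowerSeries (Fin s) k) p] (f : MvPowerSeries (Fin s) k) (q a : ℕ) :
    (powIdeal f q a).map (frobenius (MvPowerSeries (Fin s) k) p) = powIdeal f (q * p) (a * p) := by
  simp only [powIdeal, Ideal.map_sup, Ideal.map_span, Set.image_singleton, ← Set.range_comp,
    Function.comp_def, frobenius_def, ← pow_mul]

lemma finrank_powIdeal_mul_pow {k : Type*} [Field k] {s p : ℕ} [hp : Fact p.Prime] [CharP k p]
    [PerfectField k] (f : MvPowerSeries (Fin s) k) (q a j : ℕ) :
    Module.finrank k (MvPowerSeries (Fin s) k ⧸ powIdeal f (q * p ^ j) (a * p ^ j)) =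
      (p ^ j) ^ s * Module.finrank k (MvPowerSeries (Fin s) k ⧸ powIdeal f q a) := by
  have : ExpChar (MvPowerSeries (Fin s) k) p :=
    expChar_of_injective_algebraMap (algebraMap k (MvPowerSeries (Fin s) k)).injective p
  induction j with
  | zero => rw [pow_zero, mul_one, mul_one, one_pow, one_mul]
  | succ j ih =>
    rw [pow_succ, ← mul_assoc, ← mul_assoc, ← map_frobenius_powIdeal,
      finrank_quotient_map_frobenius, ih]
    ring

/-- The defining formula of `φ_{f,p}`, for every representation `a / p ^ n` of the argument. -/
theorem phi_eq {k : Type*} [Field k] {s p : ℕ} [hp : Fact p.Prime] [CharP k p]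
    [PerfectField k] (f : MvPowerSeries (Fin s) k) (a n : ℕ) (t : unitPAdic p)
    (ht : (t : ℚ) = a / (p : ℚ) ^ n) :
    phi p f t = ((p : ℚ) ^ (s * n))⁻¹ *
      (Module.finrank k (MvPowerSeries (Fin s) k ⧸ powIdeal f (p ^ n) a) : ℚ) := by
  have hp0 : p ≠ 0 := hp.out.ne_zero
  have hdvd : (t : ℚ).den ∣ p ^ n := by
    have := Rat.den_dvd (a : ℤ) ((p ^ n : ℕ) : ℤ)
    rw [Rat.divInt_eq_div] at this
    push_cast at this
    rw [← ht] at this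
    exact_mod_cast this
  obtain ⟨c, hc⟩ := hdvd
  obtain ⟨j, -, rfl⟩ := (Nat.dvd_prime_pow hp.out).1 (Dvd.intro_left _ hc.symm)
  have hnum : ((t : ℚ).num.toNat : ℤ) = (t : ℚ).num :=
    Int.toNat_of_nonneg (Rat.num_nonneg.2 t.2.1)
  have ha : a = (t : ℚ).num.toNat * p ^ j := by
    have h1 : ((t : ℚ).num : ℚ) / (t : ℚ).den = a / ((p ^ n : ℕ) : ℚ) := by
      rw [Rat.num_div_den, ht]
      push_cast
      rfl
    rw [← hnum, hc] at h1
    have hd : ((t : ℚ).den : ℚ) ≠ 0 := by exact_mod_cast (t : ℚ).den_nz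
    have hpj : (p : ℚ) ^ j ≠ 0 := pow_ne_zero _ (by exact_mod_cast hp0)
    push_cast at h1
    field_simp at h1
    have h2 : ((((t : ℚ).num.toNat : ℤ) : ℚ)) = (((t : ℚ).num.toNat : ℕ) : ℚ) := by norm_cast
    exact_mod_cast h1.symm
  have hpn : (p : ℚ) ^ (s * n) = ((t : ℚ).den : ℚ) ^ s * ((p : ℚ) ^ j) ^ s := by
    rw [← mul_pow, mul_comm s n, pow_mul]
    congr 1
    exact_mod_cast hc
  have hpj : (p : ℚ) ^ j ≠ 0 := pow_ne_zero _ (by exact_mod_cast hp0)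
  conv_rhs => rw [hpn, hc, ha, finrank_powIdeal_mul_pow]
  unfold phi
  push_cast
  field_simp

end wellDefined

end WeakFractal

end

noncomputable section

namespace WeakFractal

open MvPowerSeries

/-! ### Coordinates of a power series over its `p ^ n`-th powers -/

section coordinates

variable {k : Type*} [Field k] {s p : ℕ} [hp : Fact p.Prime] [CharP k p]

/-! Put q = p^n. As k is perfect, A is free over A^q on the monomials x^e with 0 ≤ e_i < q, and the
coordinate at x^(q-1,…,q-1), written Tr (`frobTrace`), generates all q-inverse linear maps A → A.
Hence every R-linear map R^{1/q} → R is induced by u ↦ Tr(hu) for some h (`exists_eq_frobTrace`).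
Such a form descends to R exactly when f divides Tr(hfy) for all y; for f ≠ 0 this says h ∈ (f^q :
f) = (f^(q-1)), as in Fedder's criterion.

A free summand of rank r amounts to r maps and r elements that are dual to each other. On constant
terms this duality becomes duality for the k-bilinear form sending (x, y) to the top coefficient, at
exponent (q-1,…,q-1), of f^(q-1)xy. The top coefficient is a socle functional on the Gorenstein ring
A/(x_1^q,…,x_s^q), so the form has the same kernel as multiplication by f^(q-1) into that ring, and
its rank is q^s - dim A/(x_1^q,…,x_s^q,f^(q-1)). This gives FS_R(n) = p^(sn)(1 - φ̄(1/p^n))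
(`fSignature_add_finrank`).

Rationality of a generating series and weak p-fractality both say that a sequence lies in a
finite-dimensional shift-stable space (`isRationalSeries_mk_iff`, `isWeakPFractal_iff`). That
property survives differences and multiplication by t^n, so it passes between the two sides of the
formula. The case f = 0 is computed directly. -/

lemma coeff_pow_pow_smul (g : MvPowerSeries (Fin s) k) (n : ℕ) (m : Fin s →₀ ℕ) :
    coeff (p ^ n • m) (g ^ p ^ n) = (coeff m g) ^ p ^ n := by
  rw [← map_iterateFrobenius_expand p hp.out.ne_zero, coeff_map, coeff_expand_smul,
    iterateFrobenius_def]

lemma coeff_pow_pow_not_dvd (g : MvPowerSeries (Fin s) k) (n : ℕ) (m : Fin s →₀ ℕ) (i : Fin s)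
    (h : ¬ p ^ n ∣ m i) : coeff m (g ^ p ^ n) = 0 := by
  rw [← map_iterateFrobenius_expand p hp.out.ne_zero, coeff_map, coeff_expand_of_not_dvd _ _ _ h,
    map_zero]

lemma coeff_monomial_mul_pow_pow (g : MvPowerSeries (Fin s) k) (n : ℕ) (m : Fin s →₀ ℕ)
    (e e' : Fin s → Fin (p ^ n)) :
    coeff (p ^ n • m + expo e) (monomial (expo e') 1 * g ^ p ^ n) =
      if e' = e then (coeff m g) ^ p ^ n else 0 := by
  split_ifs with h
  · subst h
    rw [add_comm, coeff_add_monomial_mul, one_mul, coeff_pow_pow_smul]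
  · rw [coeff_monomial_mul]
    split_ifs with hle
    · obtain ⟨i, hi⟩ := Function.ne_iff.1 h
      rw [one_mul]
      apply coeff_pow_pow_not_dvd _ _ _ i
      intro hd
      apply hi
      have h1 := hle i
      simp only [Finsupp.coe_tsub, Finsupp.coe_add, Finsupp.coe_smul, Pi.add_apply, Pi.sub_apply,
        Pi.smul_apply, expo_apply, smul_eq_mul] at hd h1
      have h4 := (Nat.modEq_iff_dvd' h1).2 hd
      have h5 : (e' i : ℕ) % p ^ n = (e i : ℕ) % p ^ n := by
        simpa [Nat.ModEq] using h4
      rw [Nat.mod_eq_of_lt (e i).2, Nat.mod_eq_of_lt (e' i).2] at h5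
      exact Fin.ext h5
    · rfl

lemma exists_eq_smul_add_expo {q : ℕ} (hq : 0 < q) (d : Fin s →₀ ℕ) :
    ∃ (m : Fin s →₀ ℕ) (e : Fin s → Fin q), d = q • m + expo e := by
  refine ⟨d.mapRange (fun a => a / q) (by simp), fun i => ⟨d i % q, Nat.mod_lt _ hq⟩, ?_⟩
  ext i
  simp [Nat.div_add_mod]

variable [PerfectField k]

/-- The `p ^ n`-th root of an element of a perfect field. -/
def powRoot (k : Type*) [Field k] (p n : ℕ) [Fact p.Prime] [CharP k p] [PerfectField k] :
    k ≃+* k :=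
  have : PerfectRing k p := PerfectField.toPerfectRing p
  (iterateFrobeniusEquiv k p n).symm

@[simp] lemma powRoot_pow (n : ℕ) (c : k) : powRoot k p n c ^ p ^ n = c := by
  have : PerfectRing k p := PerfectField.toPerfectRing p
  rw [← iterateFrobenius_def, ← coe_iterateFrobeniusEquiv]
  exact (iterateFrobeniusEquiv k p n).apply_symm_apply c

/-- The power series whose `p ^ n`-th power collects the terms of `u` with exponents in
`d + p ^ n ℕ ^ s`, divided by `x ^ d`. -/
def frobCoord (p n : ℕ) [Fact p.Prime] [CharP k p] (d : Fin s →₀ ℕ) :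
    MvPowerSeries (Fin s) k →+ MvPowerSeries (Fin s) k where
  toFun u := fun m => powRoot k p n (coeff (p ^ n • m + d) u)
  map_zero' := by
    ext m
    change powRoot k p n _ = 0
    simp
  map_add' u v := by
    ext m
    change powRoot k p n _ = powRoot k p n _ + powRoot k p n _
    simp

lemma coeff_frobCoord (n : ℕ) (d m : Fin s →₀ ℕ) (u : MvPowerSeries (Fin s) k) :
    coeff m (frobCoord p n d u) = powRoot k p n (coeff (p ^ n • m + d) u) := rfl

lemma sum_monomial_mul_frobCoord_pow (n : ℕ) (u : MvPowerSeries (Fin s) k) :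
    ∑ e : Fin s → Fin (p ^ n), monomial (expo e) 1 * frobCoord p n (expo e) u ^ p ^ n = u := by
  ext d
  obtain ⟨m, e, rfl⟩ := exists_eq_smul_add_expo (pow_pos hp.out.pos n) d
  simp [coeff_monomial_mul_pow_pow, coeff_frobCoord]

lemma frobCoord_sum_monomial_mul_pow (n : ℕ) (g : (Fin s → Fin (p ^ n)) → MvPowerSeries (Fin s) k)
    (e : Fin s → Fin (p ^ n)) :
    frobCoord p n (expo e) (∑ e', monomial (expo e') 1 * g e' ^ p ^ n) = g e := by
  ext m
  simp [coeff_monomial_mul_pow_pow, coeff_frobCoord, -map_sum, map_sum (coeff _)]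

/-- By uniqueness of coordinates: multiplying the expansion of u by r^q multiplies each coordinate
by r. -/
lemma frobCoord_pow_mul (n : ℕ) (e : Fin s → Fin (p ^ n)) (r u : MvPowerSeries (Fin s) k) :
    frobCoord p n (expo e) (r ^ p ^ n * u) = r * frobCoord p n (expo e) u := by
  conv_lhs => rw [← sum_monomial_mul_frobCoord_pow (p := p) n u, Finset.mul_sum]
  rw [← frobCoord_sum_monomial_mul_pow (p := p) n
    (fun e' => r * frobCoord p n (expo e') u) e]
  congr 1
  exact Finset.sum_congr rfl fun _ _ => by ring

lemma frobCoord_add_mul_monomial (n : ℕ) (d d' : Fin s →₀ ℕ) (u : MvPowerSeries (Fin s) k) :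
    frobCoord p n (d + d') (u * monomial d' 1) = frobCoord p n d u := by
  ext m
  rw [coeff_frobCoord, coeff_frobCoord, ← add_assoc, coeff_add_mul_monomial, mul_one]

/-- The exponent vector `(q - 1, …, q - 1)`. -/
def topExpo (s q : ℕ) : Fin s →₀ ℕ := Finsupp.equivFunOnFinite.symm fun _ => q - 1

@[simp] lemma topExpo_apply (s q : ℕ) (i : Fin s) : topExpo s q i = q - 1 := rfl

lemma expo_add_expo_rev {q : ℕ} (e : Fin s → Fin q) :
    expo e + expo (fun i => (e i).rev) = topExpo s q := by
  ext i
  have := (e i).2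
  simp only [Finsupp.coe_add, Pi.add_apply, expo_apply, Fin.val_rev, topExpo_apply]
  omega

lemma topExpo_eq_expo {q : ℕ} (hq : 0 < q) :
    topExpo s q = expo (fun _ => ⟨q - 1, Nat.sub_lt hq one_pos⟩) := by
  ext i
  simp

/-- The generator of the `p ^ n`-inverse linear maps `A → A`. -/
def frobTrace (p n : ℕ) [Fact p.Prime] [CharP k p] :
    MvPowerSeries (Fin s) k →+ MvPowerSeries (Fin s) k :=
  frobCoord p n (topExpo s (p ^ n))

lemma frobTrace_pow_mul (n : ℕ) (r u : MvPowerSeries (Fin s) k) :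
    frobTrace p n (r ^ p ^ n * u) = r * frobTrace p n u := by
  unfold frobTrace
  rw [topExpo_eq_expo (pow_pos hp.out.pos n), frobCoord_pow_mul]

/-- Premultiplying by the complementary monomial moves exponent e to the top one, so the trace alone
recovers every coordinate. -/
lemma frobTrace_mul_monomial_rev (n : ℕ) (u : MvPowerSeries (Fin s) k)
    (e : Fin s → Fin (p ^ n)) :
    frobTrace p n (u * monomial (expo fun i => (e i).rev) 1) = frobCoord p n (expo e) u := by
  rw [frobTrace, ← expo_add_expo_rev e, frobCoord_add_mul_monomial]

/-- The bridge from trace forms with values in A to k-bilinear forms; the q-th power removes the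
root built into the coordinates. -/
lemma constantCoeff_frobTrace_pow (n : ℕ) (u : MvPowerSeries (Fin s) k) :
    constantCoeff (frobTrace p n u) ^ p ^ n = coeff (topExpo s (p ^ n)) u := by
  rw [← coeff_zero_eq_constantCoeff_apply, frobTrace, coeff_frobCoord, powRoot_pow, smul_zero,
    zero_add]

/-- If the trace form of `h f` takes values in `(f)`, then `f ^ (p ^ n - 1)` divides `h`. -/
lemma pow_dvd_of_forall_dvd_frobTrace (n : ℕ) {f h : MvPowerSeries (Fin s) k} (hf : f ≠ 0)
    (H : ∀ y, f ∣ frobTrace p n (h * (f * y))) : f ^ (p ^ n - 1) ∣ h := by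
  -- Each coordinate of hf is a trace of hf times a monomial, hence divisible by f, and it enters
  -- the expansion through its q-th power.
  have h1 : f ^ p ^ n ∣ h * f := by
    rw [← sum_monomial_mul_frobCoord_pow (p := p) n (h * f)]
    refine Finset.dvd_sum fun e _ => Dvd.dvd.mul_left ?_ _
    rw [← frobTrace_mul_monomial_rev, mul_assoc]
    exact pow_dvd_pow_of_dvd (H _) _
  obtain ⟨w, hw⟩ := h1
  refine ⟨w, mul_right_cancel₀ hf ?_⟩
  rw [hw]
  conv_lhs => rw [← Nat.sub_add_cancel (Nat.one_le_pow n p hp.out.pos), pow_succ]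
  ring

end coordinates

/-! ### The ideal `(x₁ ^ q, …, x_s ^ q)` -/

section box

variable {k : Type*} [Field k] {s : ℕ}

lemma powIdeal_eq_sup (g : MvPowerSeries (Fin s) k) (q a : ℕ) :
    powIdeal g q a = powIdeal 0 q 1 ⊔ Ideal.span {g ^ a} := by
  simp [powIdeal]

lemma mem_powIdeal_zero_iff {q : ℕ} (u : MvPowerSeries (Fin s) k) :
    u ∈ powIdeal 0 q 1 ↔ ∀ e : Fin s → Fin q, coeff (expo e) u = 0 := by
  classical
  have h0 : powIdeal (0 : MvPowerSeries (Fin s) k) q 1 =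
      Ideal.span (Set.range fun i : Fin s => (X i : MvPowerSeries (Fin s) k) ^ q) := by
    simp [powIdeal]
  rw [h0]
  constructor
  · intro hu e
    obtain ⟨a, rfl⟩ := Ideal.mem_span_range_iff_exists_fun.1 hu
    rw [map_sum]
    refine Finset.sum_eq_zero fun i _ => ?_
    rw [X_pow_eq, coeff_mul_monomial, if_neg]
    intro h
    have := h i
    simp only [expo_apply, Finsupp.single_eq_same] at this
    exact (e i).2.not_ge this
  · intro hu
    -- Each exponent outside the box is assigned to one variable whose exponent is at least q.
    -- Splitting u by this choice gives s well-defined power series cofactors, although u has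
    -- infinitely many terms.
    let c : (Fin s →₀ ℕ) → Option (Fin s) := fun d =>
      if h : ∃ i, q ≤ d i then some h.choose else none
    have hc : ∀ d i, c d = some i → q ≤ d i := by
      intro d i h
      simp only [c] at h
      split_ifs at h with h'
      rw [← Option.some_injective _ h]
      exact h'.choose_spec
    have hn : ∀ d, c d = none → coeff d u = 0 := by
      intro d h
      simp only [c] at h
      split_ifs at h with h'
      push Not at h'
      have : d = expo fun i => ⟨d i, h' i⟩ := by ext; simp
      rw [this]
      exact hu _
    let g : Fin s → MvPowerSeries (Fin s) k := fun i d =>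
      if c (d + Finsupp.single i q) = some i then coeff (d + Finsupp.single i q) u else 0
    have hg : ∀ i d, coeff d (g i) =
      if c (d + Finsupp.single i q) = some i then coeff (d + Finsupp.single i q) u else 0 :=
      fun _ _ => rfl
    have : u = ∑ i, g i * X i ^ q := by
      ext d
      have h1 : ∀ i, coeff d (g i * X i ^ q) = if c d = some i then coeff d u else 0 := by
        intro i
        rw [X_pow_eq, coeff_mul_monomial, hg]
        by_cases h : Finsupp.single i q ≤ d
        · rw [if_pos h, mul_one, tsub_add_cancel_of_le h]
        · rw [if_neg h, if_neg]
          exact fun h' => h (Finsupp.single_le_iff.2 (hc d i h'))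
      simp only [map_sum, h1]
      cases h : c d with
      | none => simp [hn d h]
      | some i => simp
    rw [this]
    exact Ideal.sum_mem _ fun i _ => Ideal.mul_mem_left _ _ (Ideal.subset_span ⟨i, rfl⟩)

/-- The coefficients of a power series with exponents in the box `[0, q) ^ s`. -/
def boxCoeff (k : Type*) [Field k] (s q : ℕ) :
    MvPowerSeries (Fin s) k →ₗ[k] ((Fin s → Fin q) → k) :=
  LinearMap.pi fun e => coeff (expo e)

lemma boxCoeff_surjective (q : ℕ) : Function.Surjective (boxCoeff k s q) := by
  classical
  intro v
  refine ⟨∑ e, monomial (expo e) (v e), ?_⟩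
  funext e
  change coeff (expo e) (∑ e', monomial (expo e') (v e')) = v e
  rw [map_sum, Finset.sum_eq_single e]
  · simp
  · intro e' _ h
    rw [coeff_monomial, if_neg]
    intro h'
    apply h
    funext i
    exact Fin.ext (DFunLike.congr_fun h' i).symm
  · simp

lemma ker_boxCoeff (q : ℕ) :
    LinearMap.ker (boxCoeff k s q) = (powIdeal 0 q 1).restrictScalars k := by
  ext u
  rw [Submodule.restrictScalars_mem, mem_powIdeal_zero_iff, LinearMap.mem_ker, funext_iff]
  rfl

/-- `A / (x₁ ^ q, …, x_s ^ q)` has the monomials with exponents in the box as a basis. -/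
def quotientPowIdealEquiv (k : Type*) [Field k] (s q : ℕ) :
    (MvPowerSeries (Fin s) k ⧸ powIdeal (0 : MvPowerSeries (Fin s) k) q 1) ≃ₗ[k]
      ((Fin s → Fin q) → k) :=
  (Submodule.Quotient.restrictScalarsEquiv k _).symm ≪≫ₗ
    Submodule.quotEquivOfEq _ _ (ker_boxCoeff q).symm ≪≫ₗ
    (boxCoeff k s q).quotKerEquivOfSurjective (boxCoeff_surjective q)

instance (q : ℕ) : FiniteDimensional k
    (MvPowerSeries (Fin s) k ⧸ powIdeal (0 : MvPowerSeries (Fin s) k) q 1) :=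
  (quotientPowIdealEquiv k s q).symm.finiteDimensional

lemma finrank_quotient_powIdeal_zero (q : ℕ) : Module.finrank k
    (MvPowerSeries (Fin s) k ⧸ powIdeal (0 : MvPowerSeries (Fin s) k) q 1) = q ^ s := by
  rw [(quotientPowIdealEquiv k s q).finrank_eq, Module.finrank_fintype_fun_eq_card]
  simp

/-- Nondegeneracy of the socle pairing: multiplying by the complementary monomial makes any box
coefficient of u the top coefficient. -/
lemma mem_powIdeal_zero_iff_forall_mul {q : ℕ} (hq : 0 < q) (u : MvPowerSeries (Fin s) k) :
    u ∈ powIdeal 0 q 1 ↔ ∀ y, coeff (topExpo s q) (u * y) = 0 := by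
  constructor
  · intro hu y
    rw [topExpo_eq_expo hq]
    exact (mem_powIdeal_zero_iff _).1 (Ideal.mul_mem_right _ _ hu) _
  · intro H
    refine (mem_powIdeal_zero_iff _).2 fun e => ?_
    rw [← H (monomial (expo fun i => (e i).rev) 1), ← expo_add_expo_rev e, coeff_add_mul_monomial,
      mul_one]

/-- The bilinear form `(x, y) ↦ coeff_{(q - 1, …, q - 1)} (g x y)`. -/
def topForm (g : MvPowerSeries (Fin s) k) (q : ℕ) :
    MvPowerSeries (Fin s) k →ₗ[k] MvPowerSeries (Fin s) k →ₗ[k] k :=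
  (LinearMap.mul k (MvPowerSeries (Fin s) k) ∘ₗ LinearMap.mulLeft k g).compr₂
    (coeff (topExpo s q))

lemma topForm_apply (g x y : MvPowerSeries (Fin s) k) (q : ℕ) :
    topForm g q x y = coeff (topExpo s q) (g * x * y) := rfl

/-- The map `A → A / (x₁ ^ q, …, x_s ^ q)` given by multiplication by `g`. -/
def mulMod (g : MvPowerSeries (Fin s) k) (q : ℕ) : MvPowerSeries (Fin s) k →ₗ[k]
    (MvPowerSeries (Fin s) k ⧸ powIdeal (0 : MvPowerSeries (Fin s) k) q 1) :=
  (Ideal.Quotient.mkₐ k _).toLinearMap ∘ₗ LinearMap.mulLeft k g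

lemma ker_topForm (g : MvPowerSeries (Fin s) k) {q : ℕ} (hq : 0 < q) :
    LinearMap.ker (topForm g q) = LinearMap.ker (mulMod g q) := by
  ext x
  rw [LinearMap.mem_ker, LinearMap.mem_ker, LinearMap.ext_iff]
  exact (mem_powIdeal_zero_iff_forall_mul hq (g * x)).symm.trans
    Ideal.Quotient.eq_zero_iff_mem.symm

lemma mulMod_apply (g x : MvPowerSeries (Fin s) k) (q : ℕ) :
    mulMod g q x = Ideal.Quotient.mk _ g * Ideal.Quotient.mk _ x :=
  map_mul (Ideal.Quotient.mk (powIdeal (0 : MvPowerSeries (Fin s) k) q 1)) g x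

lemma ker_factor_eq_range_mulMod (g : MvPowerSeries (Fin s) k) (q : ℕ) :
    LinearMap.ker (Ideal.Quotient.factorₐ k (le_sup_left :
      powIdeal (0 : MvPowerSeries (Fin s) k) q 1 ≤ powIdeal 0 q 1 ⊔ Ideal.span {g})).toLinearMap =
      LinearMap.range (mulMod g q) := by
  ext y
  obtain ⟨u, rfl⟩ := Ideal.Quotient.mk_surjective y
  have h1 : Ideal.Quotient.mk (powIdeal (0 : MvPowerSeries (Fin s) k) q 1) u ∈
      LinearMap.ker (Ideal.Quotient.factorₐ k (le_sup_left :
      powIdeal (0 : MvPowerSeries (Fin s) k) q 1 ≤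
        powIdeal 0 q 1 ⊔ Ideal.span {g})).toLinearMap ↔
      u ∈ powIdeal 0 q 1 ⊔ Ideal.span {g} := Ideal.Quotient.eq_zero_iff_mem
  rw [h1, Submodule.mem_sup]
  constructor
  · rintro ⟨v, hv, w, hw, rfl⟩
    obtain ⟨c, rfl⟩ := Ideal.mem_span_singleton.1 hw
    refine ⟨c, ?_⟩
    rw [mulMod_apply, map_add, Ideal.Quotient.eq_zero_iff_mem.2 hv, zero_add, map_mul]
  · rintro ⟨c, hc⟩
    rw [mulMod_apply, ← map_mul, eq_comm, Ideal.Quotient.eq] at hc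
    exact ⟨_, hc, g * c, Ideal.mem_span_singleton.2 (Dvd.intro _ rfl), sub_add_cancel _ _⟩

/-- Rank-nullity for A/(x_i^q) → A/(x_i^q, g), whose kernel is the image of multiplication by g. -/
lemma finrank_range_mulMod (g : MvPowerSeries (Fin s) k) (q : ℕ) :
    Module.finrank k (LinearMap.range (mulMod g q)) + Module.finrank k
      (MvPowerSeries (Fin s) k ⧸
        (powIdeal (0 : MvPowerSeries (Fin s) k) q 1 ⊔ Ideal.span {g})) = q ^ s := by
  rw [← finrank_quotient_powIdeal_zero (k := k) q, ← ker_factor_eq_range_mulMod,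
    ← LinearMap.finrank_range_add_finrank_ker (Ideal.Quotient.factorₐ k (le_sup_left :
      powIdeal (0 : MvPowerSeries (Fin s) k) q 1 ≤ powIdeal 0 q 1 ⊔ Ideal.span {g})).toLinearMap,
    add_comm, LinearMap.range_eq_top.2, finrank_top]
  exact Ideal.Quotient.factor_surjective (le_sup_left :
    powIdeal (0 : MvPowerSeries (Fin s) k) q 1 ≤ powIdeal 0 q 1 ⊔ Ideal.span {g})

end box

/-! ### Rank of a bilinear form through dual families -/

section dualFamilies

variable {k V Q : Type*} [Field k] [AddCommGroup V] [Module k V] [AddCommGroup Q] [Module k Q]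

/-- A bilinear form with the same kernel as a map of rank `d` has dual families of length `d`. -/
lemma exists_dual_families (B : V →ₗ[k] V →ₗ[k] k) (L : V →ₗ[k] Q)
    (hBL : LinearMap.ker B = LinearMap.ker L) [FiniteDimensional k (LinearMap.range L)] :
    ∃ x y : Fin (Module.finrank k (LinearMap.range L)) → V,
      ∀ i j, B (x i) (y j) = if i = j then 1 else 0 := by
  classical
  set d := Module.finrank k (LinearMap.range L)
  let b := Module.finBasis k (LinearMap.range L)
  choose x hx using fun i => (b i).2
  let Φ : V →ₗ[k] (Fin d → k) := LinearMap.pi fun i => B (x i)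
  have hΦ : Function.Surjective Φ := by
    rw [← LinearMap.range_eq_top]
    by_contra h
    -- A functional vanishing on the range of Φ gives a combination of the x i in ker B = ker L,
    -- contradicting the independence of their images under L.
    obtain ⟨c, hc, hc0⟩ := Submodule.exists_dual_map_eq_bot_of_lt_top (lt_top_iff_ne_top.2 h)
      inferInstance
    have hcc : ∀ w : Fin d → k, c w = ∑ i, w i * c (Pi.single i 1) := by
      intro w
      conv_lhs => rw [pi_eq_sum_univ' w, map_sum]
      refine Finset.sum_congr rfl fun i _ => ?_
      rw [map_smul, smul_eq_mul]
    have hB : ∑ i, c (Pi.single i 1) • x i ∈ LinearMap.ker B := by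
      rw [LinearMap.mem_ker]
      ext v
      have h1 : c (Φ v) = 0 := by
        have : c (Φ v) ∈ (LinearMap.range Φ).map c := ⟨_, ⟨v, rfl⟩, rfl⟩
        rwa [hc0, Submodule.mem_bot] at this
      rw [hcc] at h1
      simp only [map_sum, map_smul, LinearMap.sum_apply, LinearMap.smul_apply, smul_eq_mul,
        LinearMap.zero_apply]
      rw [← h1]
      exact Finset.sum_congr rfl fun i _ => mul_comm _ _
    rw [hBL, LinearMap.mem_ker, map_sum] at hB
    have hli := Fintype.linearIndependent_iff.1 b.linearIndependent
      (fun i => c (Pi.single i 1)) (Subtype.ext (by simpa [← hx] using hB))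
    apply hc
    ext w
    simp [hli]
  choose y hy using fun j : Fin d => hΦ (Pi.single j 1)
  refine ⟨x, y, fun i j => ?_⟩
  have := congrFun (hy j) i
  simpa [Φ, Pi.single_apply] using this

/-- Dual families of length `r` force the rank of a bilinear form to be at least `r`. -/
lemma le_finrank_range_of_dual_families (B : V →ₗ[k] V →ₗ[k] k) (L : V →ₗ[k] Q)
    (hBL : LinearMap.ker B = LinearMap.ker L) [FiniteDimensional k (LinearMap.range L)] {r : ℕ}
    (x y : Fin r → V) (h : ∀ i j, B (x i) (y j) = if i = j then 1 else 0) :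
    r ≤ Module.finrank k (LinearMap.range L) := by
  have hli : LinearIndependent k fun i => L.rangeRestrict (x i) := by
    rw [Fintype.linearIndependent_iff]
    intro c hc j
    have h1 : ∑ i, c i • x i ∈ LinearMap.ker B := by
      rw [hBL, LinearMap.mem_ker]
      simpa using congrArg Subtype.val hc
    have h2 := LinearMap.congr_fun (LinearMap.mem_ker.1 h1) (y j)
    simpa [h] using h2
  simpa using hli.fintype_card_le_finrank

end dualFamilies

/-! ### Free summands of Frobenius pushforwards -/

/-- The y j define a map from the free module to M, and T⁻¹ applied to the φ i is a retraction of
it. Allowing any invertible matrix means that duality need only be arranged modulo the maximal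
ideal. -/
lemma exists_isCompl_of_isUnit_det {R M : Type*} [CommRing R] [AddCommGroup M] [Module R M]
    {d : ℕ} (φ : Fin d → M →ₗ[R] R) (y : Fin d → M)
    (h : IsUnit (Matrix.of fun i j => φ i (y j)).det) :
    ∃ F N : Submodule R M, IsCompl F N ∧ Nonempty (F ≃ₗ[R] (Fin d → R)) := by
  set T := Matrix.of fun i j => φ i (y j)
  let P : (Fin d → R) →ₗ[R] M := Fintype.linearCombination R y
  let Φ : M →ₗ[R] (Fin d → R) := T⁻¹.mulVecLin ∘ₗ LinearMap.pi φ
  have hP : ∀ v, Φ (P v) = v := by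
    intro v
    have h1 : LinearMap.pi φ (P v) = T.mulVec v := by
      funext i
      simp [P, T, Fintype.linearCombination_apply, Matrix.mulVec, dotProduct, mul_comm]
    change T⁻¹.mulVec (LinearMap.pi φ (P v)) = v
    rw [h1, Matrix.mulVec_mulVec, Matrix.nonsing_inv_mul _ h, Matrix.one_mulVec]
  refine ⟨LinearMap.range P, LinearMap.ker Φ, ?_,
    ⟨(LinearEquiv.ofInjective P (Function.LeftInverse.injective hP)).symm⟩⟩
  refine IsCompl.of_eq ?_ ?_
  · rw [eq_bot_iff]
    rintro _ ⟨⟨v, rfl⟩, hv⟩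
    have hv' : Φ (P v) = 0 := hv
    rw [hP] at hv'
    simp [hv']
  · rw [eq_top_iff]
    intro m _
    rw [Submodule.mem_sup]
    refine ⟨P (Φ m), ⟨_, rfl⟩, m - P (Φ m), ?_, by abel⟩
    rw [LinearMap.mem_ker, map_sub, hP, sub_self]

lemma exists_dual_families_of_isCompl {R M : Type*} [CommRing R] [AddCommGroup M] [Module R M]
    {r : ℕ} {F N : Submodule R M} (h : IsCompl F N) (e : F ≃ₗ[R] (Fin r → R)) :
    ∃ (φ : Fin r → M →ₗ[R] R) (y : Fin r → M), ∀ i j, φ i (y j) = if i = j then 1 else 0 := by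
  refine ⟨fun i => LinearMap.proj i ∘ₗ e.toLinearMap ∘ₗ F.projectionOnto N h,
    fun j => (e.symm (Pi.single j 1) : F), fun i j => ?_⟩
  simp [Pi.single_apply]

section frobeniusRoot

variable {k : Type*} [Field k] {s p : ℕ}
  {f : IsLocalRing.maximalIdeal (MvPowerSeries (Fin s) k)}

/-- The quotient map `A → R`, with values in `R ^ (1 / p ^ n)`. -/
def frobMk (f : IsLocalRing.maximalIdeal (MvPowerSeries (Fin s) k)) (p n : ℕ) :
    MvPowerSeries (Fin s) k →+ FrobeniusRoot (Hypersurface f) p n :=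
  (Ideal.Quotient.mk (Ideal.span {(f : MvPowerSeries (Fin s) k)})).toAddMonoidHom

lemma frobMk_surjective (n : ℕ) : Function.Surjective (frobMk f p n) :=
  Ideal.Quotient.mk_surjective

lemma frobMk_eq_zero_iff (n : ℕ) (x : MvPowerSeries (Fin s) k) :
    frobMk f p n x = 0 ↔ (f : MvPowerSeries (Fin s) k) ∣ x :=
  Ideal.Quotient.eq_zero_iff_mem.trans Ideal.mem_span_singleton

lemma hypersurface_mk_eq_zero_iff (x : MvPowerSeries (Fin s) k) :
    (Ideal.Quotient.mk _ x : Hypersurface f) = 0 ↔ (f : MvPowerSeries (Fin s) k) ∣ x :=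
  Ideal.Quotient.eq_zero_iff_mem.trans Ideal.mem_span_singleton

lemma constantCoeff_maximalIdeal :
    constantCoeff (f : MvPowerSeries (Fin s) k) = 0 := by
  by_contra h
  exact (IsLocalRing.mem_maximalIdeal _).1 f.2
    (MvPowerSeries.isUnit_iff_constantCoeff.2 (isUnit_iff_ne_zero.2 h))

variable [hp : Fact p.Prime] [CharP k p]

lemma frobMk_pow_mul (n : ℕ) (r x : MvPowerSeries (Fin s) k) :
    frobMk f p n (r ^ p ^ n * x) =
      (Ideal.Quotient.mk _ r : Hypersurface f) • frobMk f p n x := by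
  change (Ideal.Quotient.mk (Ideal.span {(f : MvPowerSeries (Fin s) k)})) (r ^ p ^ n * x) =
    iterateFrobenius (Hypersurface f) p n (Ideal.Quotient.mk _ r) * Ideal.Quotient.mk _ x
  rw [iterateFrobenius_def, map_mul, map_pow]

variable [PerfectField k]

/-- ψ is determined by its values on the monomials x^e. Lift these to a_e in A; attaching a_e^q to
the complementary monomial makes the trace return a_e times the e-th coordinate. -/
lemma exists_eq_frobTrace (n : ℕ)
    (ψ : FrobeniusRoot (Hypersurface f) p n →ₗ[Hypersurface f] Hypersurface f) :
    ∃ h, ∀ x, ψ (frobMk f p n x) = Ideal.Quotient.mk _ (frobTrace p n (h * x)) := by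
  choose a ha using fun e : Fin s → Fin (p ^ n) =>
    Ideal.Quotient.mk_surjective (ψ (frobMk f p n (monomial (expo e) 1)))
  refine ⟨∑ e, a e ^ p ^ n * monomial (expo fun i => (e i).rev) 1, fun x => ?_⟩
  have h1 : ∀ e : Fin s → Fin (p ^ n),
      frobTrace p n (a e ^ p ^ n * monomial (expo fun i => (e i).rev) 1 * x) =
        a e * frobCoord p n (expo e) x := by
    intro e
    rw [mul_assoc, frobTrace_pow_mul, mul_comm (monomial _ _), frobTrace_mul_monomial_rev]
  rw [Finset.sum_mul, map_sum, map_sum]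
  conv_lhs => rw [← sum_monomial_mul_frobCoord_pow (p := p) n x, map_sum, map_sum]
  refine Finset.sum_congr rfl fun e _ => ?_
  rw [h1, mul_comm, frobMk_pow_mul, map_smul, ← ha, map_mul, smul_eq_mul, mul_comm]

/-- The map `R ^ (1 / p ^ n) → R` induced by the trace form of `g`. -/
def traceHom (n : ℕ) (g : MvPowerSeries (Fin s) k)
    (H : ∀ y, (f : MvPowerSeries (Fin s) k) ∣ frobTrace p n (g * (f * y))) :
    FrobeniusRoot (Hypersurface f) p n →ₗ[Hypersurface f] Hypersurface f where
  toFun := QuotientAddGroup.lift (Ideal.span {(f : MvPowerSeries (Fin s) k)}).toAddSubgroup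
    ((Ideal.Quotient.mk (Ideal.span {(f : MvPowerSeries (Fin s) k)})).toAddMonoidHom.comp
      ((frobTrace p n).comp (AddMonoidHom.mulLeft g))) (by
      intro x hx
      obtain ⟨y, rfl⟩ := Ideal.mem_span_singleton.1 hx
      exact (hypersurface_mk_eq_zero_iff _).2 (H y))
  map_add' x y := map_add _ x y
  map_smul' r x := by
    obtain ⟨x, rfl⟩ := frobMk_surjective n x
    obtain ⟨r, rfl⟩ := Ideal.Quotient.mk_surjective r
    rw [← frobMk_pow_mul]
    change Ideal.Quotient.mk _ (frobTrace p n (g * (r ^ p ^ n * x))) =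
      Ideal.Quotient.mk _ r * Ideal.Quotient.mk _ (frobTrace p n (g * x))
    rw [← map_mul, ← frobTrace_pow_mul, mul_left_comm]

/-- The hypotheses say that g generates the ideal of those h whose trace form descends to R. This
treats f ≠ 0, with g = f^(q-1), and f = 0, with g = 1, together. -/
lemma fSignature_eq_finrank_range (n : ℕ) (g : MvPowerSeries (Fin s) k)
    (Hg : ∀ y, (f : MvPowerSeries (Fin s) k) ∣ frobTrace p n (g * (f * y)))
    (Hh : ∀ h, (∀ y, (f : MvPowerSeries (Fin s) k) ∣ frobTrace p n (h * (f * y))) → g ∣ h) :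
    fSignature (Hypersurface f) p n =
      Module.finrank k (LinearMap.range (mulMod g (p ^ n))) := by
  have hker := ker_topForm g (pow_pos hp.out.pos n)
  refine IsGreatest.csSup_eq ⟨?_, ?_⟩
  · obtain ⟨x, y, hxy⟩ := exists_dual_families _ _ hker
    have H : ∀ i z, (f : MvPowerSeries (Fin s) k) ∣ frobTrace p n (g * x i * (f * z)) := by
      intro i z
      have := Hg (x i * z)
      rwa [mul_left_comm (f : MvPowerSeries (Fin s) k), ← mul_assoc g] at this
    refine exists_isCompl_of_isUnit_det (fun i => traceHom n (g * x i) (H i))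
      (fun j => frobMk f p n (y j)) ?_
    let T := Matrix.of fun i j => frobTrace p n (g * x i * y j)
    have hT : (Matrix.of fun i j => traceHom n (g * x i) (H i) (frobMk f p n (y j))) =
      (Ideal.Quotient.mk (Ideal.span {(f : MvPowerSeries (Fin s) k)})).mapMatrix T := rfl
    rw [hT, ← RingHom.map_det]
    refine IsUnit.map _ (MvPowerSeries.isUnit_iff_constantCoeff.2 ?_)
    have h1 : (constantCoeff (σ := Fin s) (R := k)).mapMatrix T = 1 := by
      ext i j
      -- The form records q-th powers of the constant terms, and Frobenius is injective on k.
      apply iterateFrobenius_inj k p n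
      rw [iterateFrobenius_def, iterateFrobenius_def]
      refine (constantCoeff_frobTrace_pow n _).trans ((hxy i j).trans ?_)
      rw [Matrix.one_apply]
      split_ifs
      · rw [one_pow]
      · rw [zero_pow (pow_ne_zero _ hp.out.ne_zero)]
    rw [RingHom.map_det, h1, Matrix.det_one]
    exact isUnit_one
  · rintro r ⟨F, N, hFN, ⟨e⟩⟩
    obtain ⟨φ, y, hφ⟩ := exists_dual_families_of_isCompl hFN e
    choose h hh using fun i => exists_eq_frobTrace n (φ i)
    choose y' hy using fun j => frobMk_surjective n (y j)
    have hdvd : ∀ i, g ∣ h i := by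
      refine fun i => Hh _ fun z => ?_
      rw [← hypersurface_mk_eq_zero_iff, ← hh, (frobMk_eq_zero_iff n _).2 (Dvd.intro _ rfl),
        map_zero]
    choose x hx using hdvd
    refine le_finrank_range_of_dual_families _ _ hker x y' fun i j => ?_
    rw [topForm_apply, ← constantCoeff_frobTrace_pow, ← hx]
    have h1 := hφ i j
    rw [← hy, hh] at h1
    -- Duality in R lifts to A only modulo f, which is harmless because f has no constant term.
    have h2 : (f : MvPowerSeries (Fin s) k) ∣
        frobTrace p n (h i * y' j) - if i = j then 1 else 0 := by
      rw [← hypersurface_mk_eq_zero_iff, map_sub, h1]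
      split_ifs <;> simp
    obtain ⟨c, hc⟩ := h2
    rw [sub_eq_iff_eq_add.1 hc, map_add, map_mul, constantCoeff_maximalIdeal, zero_mul, zero_add]
    split_ifs
    · rw [map_one, one_pow]
    · rw [map_zero, zero_pow (pow_ne_zero _ hp.out.ne_zero)]

/-- The F-signature function of a hypersurface `f ≠ 0`. -/
lemma fSignature_add_finrank (hf : (f : MvPowerSeries (Fin s) k) ≠ 0) (n : ℕ) :
    fSignature (Hypersurface f) p n + Module.finrank k
      (MvPowerSeries (Fin s) k ⧸ powIdeal (f : MvPowerSeries (Fin s) k) (p ^ n) (p ^ n - 1)) =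
      (p ^ n) ^ s := by
  rw [fSignature_eq_finrank_range n ((f : MvPowerSeries (Fin s) k) ^ (p ^ n - 1)) _
    fun h => pow_dvd_of_forall_dvd_frobTrace n hf, powIdeal_eq_sup (f : MvPowerSeries (Fin s) k),
    finrank_range_mulMod]
  intro y
  rw [← mul_assoc, ← pow_succ, Nat.sub_add_cancel (Nat.one_le_pow n p hp.out.pos),
    frobTrace_pow_mul]
  exact Dvd.intro _ rfl

/-- The F-signature function of a power series ring. -/
lemma fSignature_of_eq_zero (hf : (f : MvPowerSeries (Fin s) k) = 0) (n : ℕ) :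
    fSignature (Hypersurface f) p n = (p ^ n) ^ s := by
  rw [fSignature_eq_finrank_range n 1 _ fun h _ => one_dvd h,
    ← finrank_range_mulMod (k := k) 1 (p ^ n)]
  · have : Subsingleton (MvPowerSeries (Fin s) k ⧸
        (powIdeal (0 : MvPowerSeries (Fin s) k) (p ^ n) 1 ⊔ Ideal.span {1})) := by
      rw [Ideal.Quotient.subsingleton_iff, Ideal.span_singleton_one, sup_top_eq]
    rw [left_eq_add, Module.finrank_zero_of_subsingleton]
  · intro y
    rw [hf, zero_mul, mul_zero, map_zero]

lemma restrict_reflection_phi (g : MvPowerSeries (Fin s) k) (n : ℕ) :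
    restrict p (reflection p (phi p g)) (invPow p n) = ((p : ℚ) ^ (s * n))⁻¹ *
      (Module.finrank k (MvPowerSeries (Fin s) k ⧸ powIdeal g (p ^ n) (p ^ n - 1)) : ℚ) := by
  refine phi_eq g (p ^ n - 1) n _ ?_
  have hpn : (p : ℚ) ^ n ≠ 0 := pow_ne_zero _ (by exact_mod_cast hp.out.ne_zero)
  change 1 - 1 / (p : ℚ) ^ n = _
  rw [Nat.cast_sub (Nat.one_le_pow n p hp.out.pos)]
  push_cast
  field_simp

end frobeniusRoot

/-! ### Sequences with a finite-dimensional space of shifts -/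

section recurrence

open Polynomial

/-- The shift `(a_n) ↦ (a_{n + 1})`. -/
def seqShift : Module.End ℚ (ℕ → ℚ) := LinearMap.funLeft ℚ ℚ Nat.succ

lemma seqShift_apply (a : ℕ → ℚ) (n : ℕ) : seqShift a n = a (n + 1) := rfl

lemma seqShift_pow_apply (j : ℕ) (a : ℕ → ℚ) (n : ℕ) : (seqShift ^ j) a n = a (n + j) := by
  induction j generalizing n with
  | zero => rfl
  | succ j ih =>
    rw [pow_succ', Module.End.mul_apply, seqShift_apply, ih]
    congr 1
    ring

/-- A sequence is recurrent if it lies in a finite-dimensional shift-stable space. -/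
def IsRecurrent (a : ℕ → ℚ) : Prop :=
  ∃ W : Submodule ℚ (ℕ → ℚ), FiniteDimensional ℚ W ∧ a ∈ W ∧ ∀ b ∈ W, seqShift b ∈ W

lemma isRecurrent_iff_exists_aeval (a : ℕ → ℚ) :
    IsRecurrent a ↔ ∃ c : ℚ[X], c ≠ 0 ∧ aeval seqShift c a = 0 := by
  constructor
  · rintro ⟨W, hW, ha, hS⟩
    have hmem : ∀ c : ℚ[X], aeval seqShift c a ∈ W := by
      intro c
      rw [aeval_eq_sum_range, LinearMap.sum_apply]
      refine W.sum_mem fun j hj => W.smul_mem _ ?_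
      clear hj
      induction j with
      | zero => exact ha
      | succ j ih =>
        rw [pow_succ', Module.End.mul_apply]
        exact hS _ ih
    let Φ : ℚ[X] →ₗ[ℚ] W := LinearMap.codRestrict W
      (LinearMap.applyₗ a ∘ₗ (aeval (seqShift)).toLinearMap) hmem
    have hinj : ¬ Function.Injective Φ := by
      intro h
      have : FiniteDimensional ℚ ℚ[X] := FiniteDimensional.of_injective Φ h
      exact Polynomial.not_finite (R := ℚ) this
    rw [← LinearMap.ker_eq_bot, Submodule.eq_bot_iff] at hinj
    push Not at hinj
    obtain ⟨c, hc, hc0⟩ := hinj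
    exact ⟨c, hc0, congrArg Subtype.val (LinearMap.mem_ker.1 hc)⟩
  · rintro ⟨c, hc, hca⟩
    let Φ : ℚ[X] →ₗ[ℚ] (ℕ → ℚ) := LinearMap.applyₗ a ∘ₗ (aeval (seqShift)).toLinearMap
    have hΦ : ∀ r, Φ r = aeval seqShift r a := fun _ => rfl
    -- Since c(shift) kills a, only the remainder of r modulo c matters; this bounds the dimension.
    have hmem : ∀ r, Φ r ∈ (degreeLT ℚ c.natDegree).map Φ := by
      intro r
      refine ⟨r % c, ?_, ?_⟩
      · rw [SetLike.mem_coe, mem_degreeLT, ← degree_eq_natDegree hc]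
        exact EuclideanDomain.mod_lt r hc
      · conv_rhs => rw [← EuclideanDomain.mod_add_div r c]
        rw [hΦ, hΦ, map_add, mul_comm, map_mul, LinearMap.add_apply, Module.End.mul_apply, hca,
          map_zero, add_zero]
    have : FiniteDimensional ℚ (degreeLT ℚ c.natDegree) :=
      (degreeLTEquiv ℚ c.natDegree).symm.finiteDimensional
    refine ⟨(degreeLT ℚ c.natDegree).map Φ, inferInstance, ?_, ?_⟩
    · simpa [hΦ] using hmem 1
    · rintro _ ⟨r, -, rfl⟩
      have : seqShift (Φ r) = Φ (Polynomial.X * r) := by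
        rw [hΦ, hΦ, map_mul, aeval_X, Module.End.mul_apply]
      rw [this]
      exact hmem _

/-- Multiplication by Q acts on high coefficients as the reversed polynomial in the shift. D may
exceed the degree of Q, leaving room to pass the degree of a numerator. -/
lemma coeff_mul_mk_eq_aeval_reflect (Q : ℚ[X]) (D : ℕ) (hD : Q.natDegree ≤ D) (a : ℕ → ℚ)
    (n : ℕ) : PowerSeries.coeff (n + D) ((Q : PowerSeries ℚ) * PowerSeries.mk a) =
      aeval seqShift (Q.reflect D) a n := by
  have hsup : (Q.reflect D).natDegree < D + 1 := by
    rw [Nat.lt_succ_iff, natDegree_le_iff_coeff_eq_zero]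
    intro N hN
    rw [coeff_reflect, revAt_eq_self_of_lt hN]
    exact coeff_eq_zero_of_natDegree_lt (hD.trans_lt hN)
  rw [aeval_eq_sum_range' hsup, LinearMap.sum_apply, Finset.sum_apply, PowerSeries.coeff_mul,
    Finset.Nat.sum_antidiagonal_eq_sum_range_succ_mk]
  simp only [coeff_coe, PowerSeries.coeff_mk, LinearMap.smul_apply, Pi.smul_apply,
    seqShift_pow_apply, smul_eq_mul]
  rw [← Finset.sum_range_reflect (fun j => (Q.reflect D).coeff j * a (n + j)), ← Finset.sum_subset
    (Finset.range_mono (by omega : D + 1 ≤ (n + D).succ))]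
  · refine Finset.sum_congr rfl fun j hj => ?_
    have hj' : j ≤ D := Nat.lt_succ_iff.1 (Finset.mem_range.1 hj)
    rw [coeff_reflect, revAt_le (by omega)]
    congr 2 <;> omega
  · intro j _ hj
    rw [Finset.mem_range, not_lt] at hj
    rw [coeff_eq_zero_of_natDegree_lt (by omega), zero_mul]

lemma isRationalSeries_mk_iff (a : ℕ → ℚ) :
    IsRationalSeries (PowerSeries.mk a) ↔ IsRecurrent a := by
  rw [isRecurrent_iff_exists_aeval]
  constructor
  · rintro ⟨P, Q, hQ, h⟩
    -- The extra deg P + 1 puts every coefficient being read beyond the degree of P.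
    refine ⟨Q.reflect (Q.natDegree + (P.natDegree + 1)), ?_, ?_⟩
    · rwa [Ne, reflect_eq_zero_iff]
    · funext n
      rw [← coeff_mul_mk_eq_aeval_reflect Q _ (Nat.le_add_right _ _), h, coeff_coe]
      exact coeff_eq_zero_of_natDegree_lt (by omega)
  · rintro ⟨c, hc, hca⟩
    have hdeg : (c.reflect c.natDegree).natDegree ≤ c.natDegree := by
      rw [natDegree_le_iff_coeff_eq_zero]
      intro N hN
      rw [coeff_reflect, revAt_eq_self_of_lt hN]
      exact coeff_eq_zero_of_natDegree_lt hN
    refine ⟨(((c.reflect c.natDegree : ℚ[X]) : PowerSeries ℚ) * PowerSeries.mk a).trunc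
      c.natDegree, c.reflect c.natDegree, ?_, ?_⟩
    · rwa [Ne, reflect_eq_zero_iff]
    · ext N
      rw [coeff_coe, PowerSeries.coeff_trunc]
      split_ifs with hN
      · rfl
      · rw [← Nat.sub_add_cancel (not_lt.1 hN), coeff_mul_mk_eq_aeval_reflect _ _ hdeg,
          reflect_reflect, hca]
        rfl

lemma IsRecurrent.sub {a b : ℕ → ℚ} (ha : IsRecurrent a) (hb : IsRecurrent b) :
    IsRecurrent (a - b) := by
  obtain ⟨V, hV, haV, hSV⟩ := ha
  obtain ⟨W, hW, hbW, hSW⟩ := hb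
  refine ⟨V ⊔ W, inferInstance, ?_, ?_⟩
  · exact Submodule.sub_mem _ (Submodule.mem_sup_left haV) (Submodule.mem_sup_right hbW)
  · intro c hc
    obtain ⟨v, hv, w, hw, rfl⟩ := Submodule.mem_sup.1 hc
    rw [map_add]
    exact Submodule.add_mem_sup (hSV v hv) (hSW w hw)

lemma IsRecurrent.pow_mul {a : ℕ → ℚ} (ha : IsRecurrent a) (t : ℚ) :
    IsRecurrent (fun n => t ^ n * a n) := by
  obtain ⟨W, hW, haW, hSW⟩ := ha
  let D : (ℕ → ℚ) →ₗ[ℚ] (ℕ → ℚ) := LinearMap.mulLeft ℚ (fun n => t ^ n)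
  refine ⟨W.map D, inferInstance, ⟨a, haW, rfl⟩, ?_⟩
  rintro _ ⟨b, hb, rfl⟩
  refine ⟨t • seqShift b, W.smul_mem _ (hSW b hb), ?_⟩
  funext n
  change t ^ n * (t * b (n + 1)) = t ^ (n + 1) * b (n + 1)
  ring

lemma isRecurrent_of_seqShift_eq_smul {a : ℕ → ℚ} (t : ℚ) (ha : seqShift a = t • a) :
    IsRecurrent a := by
  refine ⟨ℚ ∙ a, inferInstance, Submodule.mem_span_singleton_self a, fun b hb => ?_⟩
  obtain ⟨c, rfl⟩ := Submodule.mem_span_singleton.1 hb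
  rw [map_smul, ha]
  exact Submodule.smul_mem _ _ (Submodule.smul_mem _ _ (Submodule.mem_span_singleton_self a))

lemma isRecurrent_pow (t : ℚ) : IsRecurrent (fun n => t ^ n) :=
  isRecurrent_of_seqShift_eq_smul t (funext fun n => pow_succ' t n)

/-- `𝓥` is enumerated by `ℕ`. -/
def invPowersEquiv (p : ℕ) [hp : Fact p.Prime] : ℕ ≃ invPowers p :=
  Equiv.ofBijective (invPow p) <| by
    constructor
    · intro m n h
      have h1 : 1 / (p : ℚ) ^ m = 1 / (p : ℚ) ^ n := congrArg Subtype.val h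
      rw [one_div, one_div, inv_inj] at h1
      exact Nat.pow_right_injective hp.out.two_le (by exact_mod_cast h1)
    · rintro ⟨t, m, rfl⟩
      exact ⟨m, rfl⟩

lemma isWeakPFractal_iff (p : ℕ) [Fact p.Prime] (φ : invPowers p → ℚ) :
    IsWeakPFractal p φ ↔ IsRecurrent (fun n => φ (invPow p n)) := by
  let E : (invPowers p → ℚ) ≃ₗ[ℚ] (ℕ → ℚ) := LinearEquiv.funCongrLeft ℚ ℚ (invPowersEquiv p)
  have hE : ∀ ψ n, E ψ n = ψ (invPow p n) := fun _ _ => rfl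
  have hES : ∀ n ψ, E (shift p n ψ) = (seqShift ^ n) (E ψ) := by
    intro n ψ
    funext m
    rw [hE, shift_invPow, seqShift_pow_apply, hE]
  constructor
  · rintro ⟨W, hW, hφ, hS⟩
    refine ⟨W.map (E : (invPowers p → ℚ) →ₗ[ℚ] (ℕ → ℚ)), inferInstance, ⟨φ, hφ, rfl⟩, ?_⟩
    rintro _ ⟨ψ, hψ, rfl⟩
    refine ⟨shift p 1 ψ, hS 1 ψ hψ, ?_⟩
    exact (hES 1 ψ).trans (by rw [pow_one]; rfl)
  · rintro ⟨W, hW, hφ, hS⟩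
    refine ⟨W.map (E.symm : (ℕ → ℚ) →ₗ[ℚ] (invPowers p → ℚ)), inferInstance,
      ⟨E φ, hφ, E.symm_apply_apply φ⟩, ?_⟩
    rintro n _ ⟨b, hb, rfl⟩
    refine ⟨(seqShift ^ n) b, ?_, ?_⟩
    · induction n with
      | zero => exact hb
      | succ n ih =>
        rw [pow_succ', Module.End.mul_apply]
        exact hS _ ih
    · apply E.injective
      rw [hES]
      exact (E.apply_symm_apply _).trans (by rw [LinearEquiv.coe_coe, E.apply_symm_apply])

end recurrence

end WeakFractal

end

/-! ### Comparison of the two sequences -/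

theorem mainTheorem3 {k : Type*} [Field k] [PerfectField k] (p : ℕ) [Fact p.Prime] [CharP k p]
    (s : ℕ) (f : IsLocalRing.maximalIdeal (MvPowerSeries (Fin s) k)) :
    WeakFractal.IsRationalSeries (WeakFractal.fSignatureSeries (WeakFractal.Hypersurface f) p) ↔
      WeakFractal.IsWeakPFractal p
        (WeakFractal.restrict p (WeakFractal.reflection p
          (WeakFractal.phi p (f : MvPowerSeries (Fin s) k)))) := by
  have hp : p.Prime := Fact.out
  have ht : ((p : ℚ) ^ s) ≠ 0 := pow_ne_zero _ (by exact_mod_cast hp.ne_zero)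
  rw [WeakFractal.fSignatureSeries, WeakFractal.isRationalSeries_mk_iff,
    WeakFractal.isWeakPFractal_iff]
  simp only [WeakFractal.restrict_reflection_phi]
  by_cases hf : (f : MvPowerSeries (Fin s) k) = 0
  · simp only [WeakFractal.fSignature_of_eq_zero hf]
    refine iff_of_true ?_ ?_
    · convert WeakFractal.isRecurrent_pow ((p : ℚ) ^ s) using 2 with n
      push_cast
      rw [← pow_mul, ← pow_mul, mul_comm]
    -- For f = 0 the reflected values are 1 for n ≥ 1 but 0 at n = 0, where f^0 = 1 generates the
    -- unit ideal. The correction is the delta sequence at 0, which the shift kills.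
    · have h0 : WeakFractal.IsRecurrent (fun n => if n = 0 then 1 else 0) :=
        WeakFractal.isRecurrent_of_seqShift_eq_smul 0 (by
          funext n
          simp [WeakFractal.seqShift_apply])
      convert (WeakFractal.isRecurrent_pow 1).sub h0 using 2 with n
      rw [Pi.sub_apply, one_pow]
      split_ifs with hn
      · subst hn
        have : Subsingleton (MvPowerSeries (Fin s) k ⧸
            WeakFractal.powIdeal (f : MvPowerSeries (Fin s) k) (p ^ 0) (p ^ 0 - 1)) := by
          rw [Ideal.Quotient.subsingleton_iff, WeakFractal.powIdeal]
          simp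
        rw [Module.finrank_zero_of_subsingleton]
        simp
      · have h1 : p ^ n - 1 ≠ 0 := by
          have := Nat.one_lt_pow hn hp.one_lt
          omega
        have h2 : WeakFractal.powIdeal (f : MvPowerSeries (Fin s) k) (p ^ n) (p ^ n - 1) =
            WeakFractal.powIdeal (0 : MvPowerSeries (Fin s) k) (p ^ n) 1 := by
          simp [WeakFractal.powIdeal, h1, hf]
        rw [h2, WeakFractal.finrank_quotient_powIdeal_zero, mul_comm s n, pow_mul]
        push_cast
        rw [inv_mul_cancel₀ (pow_ne_zero _ (pow_ne_zero _ (by exact_mod_cast hp.ne_zero))),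
          sub_zero]
  -- Both directions solve FS_R(n) = p^(sn)(1 - φ̄(1/p^n)) for one of the two sequences.
  · have hq := fun n => congrArg (Nat.cast (R := ℚ)) (WeakFractal.fSignature_add_finrank hf n)
    push_cast at hq
    have hpow : ∀ n, ((p : ℚ) ^ n) ^ s = ((p : ℚ) ^ s) ^ n := fun n => by
      rw [← pow_mul, ← pow_mul, mul_comm]
    constructor
    · intro h
      convert (WeakFractal.isRecurrent_pow 1).sub (h.pow_mul ((p : ℚ) ^ s)⁻¹) using 2 with n
      rw [Pi.sub_apply, one_pow, eq_sub_of_add_eq (hq n), hpow, pow_mul, inv_pow]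
      field_simp
      ring
    · intro h
      convert ((WeakFractal.isRecurrent_pow 1).sub h).pow_mul ((p : ℚ) ^ s) using 2 with n
      rw [Pi.sub_apply, one_pow, eq_sub_of_add_eq (hq n), hpow, pow_mul]
      field_simp
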